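/- Let $n$ be a nonnegative integer. The parts of a partition are listed in weakly decreasing order $\lambda_1\ge\lambda_2\ge\cdots\ge\lambda_k\ge1$, and two parts are called adjacent if they are consecutive entries $\lambda_i,\lambda_{i+1}$ of this list. Let $C_1(n)$ be the number of partitions of $n$ into parts congruent to $0$, $1$, $3$, or $5 \pmod 6$. Let $C_2(n)$ be the number of partitions of $n$ that satisfy the following conditions: - If adjacent parts differ by exactly $1$, the smaller part is not $\equiv 1 \pmod 3$. (Equivalently, if adjacent parts differ by exactly $1$, their sum is not $\equiv 0 \pmod 3$.) - If adjacent parts differ by exactly $2$, the smaller part is $\equiv 2 \pmod 3$. (Equivalently, if adjacent parts differ by exactly $2$, their sum is $\equiv 0 \pmod 3$.) - No part is equal to $2$. Then $C_1(n)=C_2(n)$. -/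

import Mathlib

/-- The parts of a partition, listed in weakly decreasing order `λ₁ ≥ λ₂ ≥ ⋯ ≥ λₖ`. -/
def partsList {n : ℕ} (p : n.Partition) : List ℕ :=
  p.parts.sort (fun a b => b ≤ a)

/-- `a` and `b` are adjacent parts of `p`, the part `a` coming immediately before `b` in the weakly
decreasing list of the parts (so `b ≤ a`). -/
def AdjacentParts {n : ℕ} (p : n.Partition) (a b : ℕ) : Prop :=
  [a, b] <:+: partsList p

/-- The partitions of `n` into parts congruent to `0`, `1`, `3` or `5` modulo `6`. -/
def partitionsC₁ (n : ℕ) : Set n.Partition :=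
  {p | ∀ i ∈ p.parts, i ≡ 0 [MOD 6] ∨ i ≡ 1 [MOD 6] ∨ i ≡ 3 [MOD 6] ∨ i ≡ 5 [MOD 6]}

/-- The partitions of `n` without a part equal to `2`, in which the smaller of two adjacent parts
that differ by exactly `1` is not congruent to `1` modulo `3`, and the smaller of two adjacent parts
that differ by exactly `2` is congruent to `2` modulo `3`. -/
def partitionsC₂ (n : ℕ) : Set n.Partition :=
  {p | (∀ a b : ℕ, AdjacentParts p a b → a = b + 1 → ¬ b ≡ 1 [MOD 3]) ∧
    (∀ a b : ℕ, AdjacentParts p a b → a = b + 2 → b ≡ 2 [MOD 3]) ∧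
    2 ∉ p.parts}

/-- The number of partitions in `partitionsC₁ n`. -/
noncomputable def C₁ (n : ℕ) : ℕ := (partitionsC₁ n).ncard

/-- The number of partitions in `partitionsC₂ n`. -/
noncomputable def C₂ (n : ℕ) : ℕ := (partitionsC₂ n).ncard

/-!
The excluded pairs of parts, `{3k + 1, 3k + 2}`, `{3k + 1, 3k + 3}` and `{3k, 3k + 2}`, are the
edges of a path `diffGraph`, and a partition satisfies the difference conditions exactly when the set of
its parts is independent in this path (`mem_partitionsC₂_iff`). Padding with zeros, the partitions
of `n` without a part `2` become multisets of a prescribed size `N ≥ n`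
(`ncard_card_eq_of_cons_zero`), which is what makes a recursion in `N` available: deleting a vertex
expresses a generating function of size `N` through one of size `N - 1`
(`indepSeries_succ`), and translating the path by `3` multiplies it by `X ^ (3 * N)`
(`indepSeries_shift`).

Applying this to the vertices `0`, `1`, `3`, `4`, `5` gives a closed linear recursion for the
generating functions of the multisets with elements in `{x ≠ 2}`, `{1} ∪ [4, ∞)` and `[5, ∞)`. Unrestricted
multisets of numbers congruent to `0`, `1` or `5` modulo `6` (the edgeless graph, translated by `6`)
satisfy a similar one, and the two solutions differ by the factor
`∏_{j ≤ N} (1 + X ^ (3 * j))` (`indepSeries_diffGraph_eq`). For large `N` that factor generates the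
partitions into distinct multiples of `3`, equivalently, by Euler, those into odd multiples of `3`
(`X_pow_dvd_euler_product_sub_one`). These supply the parts congruent to `3` modulo `6`.
-/

open PowerSeries

/-! ### Generating functions of families of multisets -/

/-- The generating function `∑ X ^ s.sum` of the multisets `s ∈ A`. The coefficients are
meaningful when `A` has finitely many members of each sum, see `FiniteFibers`. -/
noncomputable def sumSeries (A : Set (Multiset ℕ)) : ℤ⟦X⟧ :=
  PowerSeries.mk fun n => (({s ∈ A | s.sum = n} : Set (Multiset ℕ)).ncard : ℤ)

/-- `A` has finitely many members of each sum. -/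
def FiniteFibers (A : Set (Multiset ℕ)) : Prop :=
  ∀ n, ({s ∈ A | s.sum = n} : Set (Multiset ℕ)).Finite

theorem FiniteFibers.mono {A B : Set (Multiset ℕ)} (hB : FiniteFibers B) (h : A ⊆ B) :
    FiniteFibers A :=
  fun n => (hB n).subset fun _ hs => ⟨h hs.1, hs.2⟩

theorem finite_card_le_sum_eq (N n : ℕ) :
    {s : Multiset ℕ | s.card ≤ N ∧ s.sum = n}.Finite := by
  refine (Set.finite_Iic (N • (Multiset.range (n + 1)))).subset ?_
  rintro s ⟨hN, hn⟩
  rw [Set.mem_Iic, Multiset.le_iff_count]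
  intro a
  by_cases ha : a ∈ s
  · have h1 : a ≤ n := hn ▸ Multiset.le_sum_of_mem ha
    rw [Multiset.count_nsmul, Multiset.count_eq_one_of_mem (Multiset.nodup_range _)
      (Multiset.mem_range.2 (by omega)), mul_one]
    exact (Multiset.count_le_card a s).trans hN
  · rw [Multiset.count_eq_zero_of_notMem ha]
    exact Nat.zero_le _

theorem finiteFibers_card_eq (N : ℕ) : FiniteFibers {s | s.card = N} :=
  fun n => (finite_card_le_sum_eq N n).subset fun _ hs => ⟨hs.1.le, hs.2⟩

theorem finiteFibers_zero_notMem : FiniteFibers {s | 0 ∉ s} := by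
  refine fun n => (finite_card_le_sum_eq n n).subset ?_
  rintro s ⟨h0, rfl⟩
  have h : ∀ x ∈ s, 1 ≤ x := fun x hx => Nat.one_le_iff_ne_zero.2 fun h => h0 (h ▸ hx)
  refine ⟨?_, rfl⟩
  simpa using Multiset.card_nsmul_le_sum h

/-- Separating the members of `A` by whether they contain `v`, and removing one copy of `v`
if they do. -/
theorem sumSeries_split {A : Set (Multiset ℕ)} (hA : FiniteFibers A) (v : ℕ) :
    sumSeries A = sumSeries {s ∈ A | v ∉ s} + X ^ v * sumSeries {t | v ::ₘ t ∈ A} := by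
  ext n
  have hsplit : ({s ∈ A | s.sum = n} : Set (Multiset ℕ)) =
      {s ∈ {s ∈ A | v ∉ s} | s.sum = n} ∪ {s ∈ {s ∈ A | v ∈ s} | s.sum = n} := by
    ext s; simp only [Set.mem_ofPred_eq, Set.mem_union]; tauto
  have hcard : ({s ∈ A | s.sum = n} : Set (Multiset ℕ)).ncard =
      ({s ∈ {s ∈ A | v ∉ s} | s.sum = n} : Set (Multiset ℕ)).ncard +
      ({s ∈ {s ∈ A | v ∈ s} | s.sum = n} : Set (Multiset ℕ)).ncard := by
    rw [hsplit]
    refine Set.ncard_union_eq ?_ (hA.mono (fun _ h => h.1) n) (hA.mono (fun _ h => h.1) n)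
    exact Set.disjoint_left.2 fun s h1 h2 => h1.1.2 h2.1.2
  rw [map_add, coeff_X_pow_mul', sumSeries, sumSeries, sumSeries, coeff_mk, coeff_mk, hcard,
    Nat.cast_add]
  congr 1
  split_ifs with hv
  · rw [coeff_mk]
    have : ({s ∈ {s ∈ A | v ∈ s} | s.sum = n} : Set (Multiset ℕ)) =
        (v ::ₘ ·) '' {t ∈ {t | v ::ₘ t ∈ A} | t.sum = n - v} := by
      ext s
      simp only [Set.mem_ofPred_eq, Set.mem_image]
      constructor
      · rintro ⟨⟨hs, hvs⟩, hn⟩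
        obtain ⟨t, rfl⟩ := Multiset.exists_cons_of_mem hvs
        rw [Multiset.sum_cons] at hn
        exact ⟨t, ⟨hs, by omega⟩, rfl⟩
      · rintro ⟨t, ⟨ht, hn⟩, rfl⟩
        refine ⟨⟨ht, Multiset.mem_cons_self _ _⟩, ?_⟩
        rw [Multiset.sum_cons]; omega
    rw [this, Set.ncard_image_of_injective _ fun _ _ h => (Multiset.cons_inj_right v).1 h]
  · have : ({s ∈ {s ∈ A | v ∈ s} | s.sum = n} : Set (Multiset ℕ)) = ∅ := by
      ext s
      simp only [Set.mem_ofPred_eq, Set.mem_empty_iff_false, iff_false]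
      rintro ⟨⟨-, hvs⟩, rfl⟩
      exact hv (Multiset.le_sum_of_mem hvs)
    rw [this, Set.ncard_empty, Nat.cast_zero]

/-! ### Multisets supported on independent sets -/

/-- The multisets with `N` elements, all in `V`, whose underlying set is independent in `G`. -/
def indepMultisets (G : SimpleGraph ℕ) (V : Set ℕ) (N : ℕ) : Set (Multiset ℕ) :=
  {s | s.card = N ∧ (∀ x ∈ s, x ∈ V) ∧ G.IsIndepSet {x | x ∈ s}}

/-- The generating function of `indepMultisets G V N` by sum. -/
noncomputable def indepSeries (G : SimpleGraph ℕ) (V : Set ℕ) (N : ℕ) : ℤ⟦X⟧ :=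
  sumSeries (indepMultisets G V N)

theorem isIndepSet_cons_iff (G : SimpleGraph ℕ) (v : ℕ) (t : Multiset ℕ) :
    G.IsIndepSet {x | x ∈ v ::ₘ t} ↔ G.IsIndepSet {x | x ∈ t} ∧ ∀ x ∈ t, ¬ G.Adj v x := by
  have : {x | x ∈ v ::ₘ t} = insert v {x | x ∈ t} := by ext; simp
  rw [this, SimpleGraph.IsIndepSet, Set.pairwise_insert, SimpleGraph.IsIndepSet]
  refine and_congr_right fun _ => forall₂_congr fun x _ => ⟨fun h hvx => ?_, fun h _ => ?_⟩
  · exact (h hvx.ne).1 hvx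
  · exact ⟨h, fun h' => h h'.symm⟩

theorem indepSeries_zero (G : SimpleGraph ℕ) (V : Set ℕ) : indepSeries G V 0 = 1 := by
  ext n
  rw [indepSeries, sumSeries, coeff_mk, coeff_one]
  have : ({s ∈ indepMultisets G V 0 | s.sum = n} : Set (Multiset ℕ)) =
      if n = 0 then {0} else ∅ := by
    ext s
    simp only [indepMultisets, Multiset.card_eq_zero, Set.mem_ofPred_eq]
    split_ifs with hn
    · constructor
      · exact fun h => h.1.1
      · rintro rfl
        exact ⟨⟨rfl, by simp, by simp [SimpleGraph.IsIndepSet]⟩, by simp [hn]⟩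
    · simp only [Set.mem_empty_iff_false, iff_false]
      rintro ⟨⟨rfl, -⟩, h⟩
      exact hn (by simpa using h.symm)
  rw [this]
  split_ifs <;> simp

/-- Deletion of the vertex `v`: a multiset avoids `v`, or contains it and then avoids its
neighbours. -/
theorem indepSeries_succ (G : SimpleGraph ℕ) {V : Set ℕ} {v : ℕ} (hv : v ∈ V) (N : ℕ) :
    indepSeries G V (N + 1) = indepSeries G (V \ {v}) (N + 1) +
      X ^ v * indepSeries G {x ∈ V | ¬ G.Adj v x} N := by
  rw [indepSeries, sumSeries_split ((finiteFibers_card_eq (N + 1)).mono fun _ h => h.1) v]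
  congr 2
  · congr 1
    ext s
    simp only [indepMultisets, Set.mem_ofPred_eq, Set.mem_sdiff, Set.mem_singleton_iff]
    constructor
    · rintro ⟨⟨h1, h2, h3⟩, h4⟩
      exact ⟨h1, fun x hx => ⟨h2 x hx, fun h => h4 (h ▸ hx)⟩, h3⟩
    · rintro ⟨h1, h2, h3⟩
      exact ⟨⟨h1, fun x hx => (h2 x hx).1, h3⟩, fun h => (h2 v h).2 rfl⟩
  · congr 1
    ext t
    simp only [indepMultisets, Set.mem_ofPred_eq, isIndepSet_cons_iff, Multiset.card_cons,
      Multiset.forall_mem_cons, Nat.add_right_cancel_iff]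
    constructor
    · rintro ⟨h1, ⟨-, h2⟩, h3, h4⟩
      exact ⟨h1, fun x hx => ⟨h2 x hx, h4 x hx⟩, h3⟩
    · rintro ⟨h1, h2, h3⟩
      exact ⟨h1, ⟨hv, fun x hx => (h2 x hx).1⟩, h3, fun x hx => (h2 x hx).2⟩

/-- Translating the vertices by `k` multiplies the generating function of the multisets with
`N` elements by `X ^ (k * N)`. -/
theorem indepSeries_shift (G : SimpleGraph ℕ) {k : ℕ}
    (hG : ∀ x y, G.Adj (x + k) (y + k) ↔ G.Adj x y) (V : Set ℕ) (N : ℕ) :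
    indepSeries G ((· + k) '' V) N = X ^ (k * N) * indepSeries G V N := by
  have himage : indepMultisets G ((· + k) '' V) N =
      Multiset.map (· + k) '' indepMultisets G V N := by
    ext s
    simp only [indepMultisets, Set.mem_ofPred_eq, Set.mem_image]
    constructor
    · rintro ⟨h1, h2, h3⟩
      have hs : (s.map (· - k)).map (· + k) = s := by
        rw [Multiset.map_map]
        refine (Multiset.map_congr rfl fun x hx => ?_).trans (Multiset.map_id s)
        obtain ⟨y, -, rfl⟩ := h2 x hx
        simp
      refine ⟨s.map (· - k), ⟨by simpa using h1, ?_, ?_⟩, hs⟩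
      · intro x hx
        obtain ⟨z, hz, rfl⟩ := Multiset.mem_map.1 hx
        obtain ⟨y, hy, rfl⟩ := h2 z hz
        simpa using hy
      · intro x hx y hy hxy hadj
        refine h3 (x := x + k) ?_ (y := y + k) ?_ (by omega) ((hG x y).2 hadj)
        · rw [Set.mem_ofPred_eq, ← hs]; exact Multiset.mem_map_of_mem _ hx
        · rw [Set.mem_ofPred_eq, ← hs]; exact Multiset.mem_map_of_mem _ hy
    · rintro ⟨t, ⟨h1, h2, h3⟩, rfl⟩
      refine ⟨by simpa using h1, ?_, ?_⟩
      · intro x hx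
        obtain ⟨z, hz, rfl⟩ := Multiset.mem_map.1 hx
        exact ⟨z, h2 z hz, rfl⟩
      · intro x hx y hy hxy hadj
        obtain ⟨u, hu, rfl⟩ := Multiset.mem_map.1 hx
        obtain ⟨w, hw, rfl⟩ := Multiset.mem_map.1 hy
        exact h3 (x := u) hu (y := w) hw (fun h => hxy (congrArg (· + k) h)) ((hG u w).1 hadj)
  have hsum : ∀ t ∈ indepMultisets G V N, (t.map (· + k)).sum = t.sum + k * N := by
    rintro t ⟨rfl, -⟩
    simp [Multiset.sum_map_add, mul_comm]
  ext n
  rw [coeff_X_pow_mul', indepSeries, indepSeries, sumSeries, sumSeries, coeff_mk, himage]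
  split_ifs with hn
  · rw [coeff_mk]
    have : ({s ∈ Multiset.map (· + k) '' indepMultisets G V N | s.sum = n} : Set (Multiset ℕ)) =
        Multiset.map (· + k) '' {t ∈ indepMultisets G V N | t.sum = n - k * N} := by
      ext s
      constructor
      · rintro ⟨⟨t, ht, rfl⟩, h⟩
        exact ⟨t, ⟨ht, by have := hsum t ht; omega⟩, rfl⟩
      · rintro ⟨t, ⟨ht, h⟩, rfl⟩
        exact ⟨⟨t, ht, rfl⟩, by have := hsum t ht; omega⟩
    rw [this, Set.ncard_image_of_injective _ (Multiset.map_injective (add_left_injective k))]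
  · have : ({s ∈ Multiset.map (· + k) '' indepMultisets G V N | s.sum = n} :
        Set (Multiset ℕ)) = ∅ := by
      refine Set.eq_empty_of_forall_notMem ?_
      rintro s ⟨⟨t, ht, rfl⟩, h⟩
      have := hsum t ht
      omega
    rw [this, Set.ncard_empty, Nat.cast_zero]

/-! ### Padding with zeros -/

/-- A multiset of sum `n` is determined by its nonzero elements once its size is prescribed, and
any size `N ≥ n` is possible. -/
theorem ncard_card_eq_of_cons_zero {A : Set (Multiset ℕ)} (hA : ∀ s, 0 ::ₘ s ∈ A ↔ s ∈ A)
    {n N : ℕ} (hn : n ≤ N) :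
    ({s | s ∈ A ∧ s.card = N ∧ s.sum = n} : Set (Multiset ℕ)).ncard =
      ({s | s ∈ A ∧ 0 ∉ s ∧ s.sum = n} : Set (Multiset ℕ)).ncard := by
  have hrep : ∀ (m : ℕ) (s : Multiset ℕ), Multiset.replicate m 0 + s ∈ A ↔ s ∈ A := by
    intro m s
    induction m with
    | zero => simp
    | succ m ih => rw [Multiset.replicate_succ, Multiset.cons_add, hA, ih]
  have hdec : ∀ s : Multiset ℕ, Multiset.replicate (s.count 0) 0 + s.filter (· ≠ 0) = s := by
    intro s
    rw [← Multiset.filter_eq']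
    exact Multiset.filter_add_not (· = 0) s
  refine Set.ncard_congr (fun s _ => s.filter (· ≠ 0)) ?_ ?_ ?_
  · rintro s ⟨h1, -, h3⟩
    rw [← hdec s, hrep] at h1
    refine ⟨h1, by simp, ?_⟩
    rw [← hdec s] at h3
    simpa using h3
  · rintro s t ⟨-, h2, -⟩ ⟨-, h2', -⟩ (h : s.filter (· ≠ 0) = t.filter (· ≠ 0))
    have hs := congrArg Multiset.card (hdec s)
    have ht := congrArg Multiset.card (hdec t)
    rw [Multiset.card_add, Multiset.card_replicate] at hs ht
    rw [← hdec s, ← hdec t, h]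
    rw [h] at hs
    congr 2
    omega
  · rintro s ⟨h1, h2, h3⟩
    have hc : s.card ≤ N := by
      have h : ∀ x ∈ s, 1 ≤ x := fun x hx => Nat.one_le_iff_ne_zero.2 fun h => h2 (h ▸ hx)
      have := Multiset.card_nsmul_le_sum h
      rw [smul_eq_mul, mul_one] at this
      omega
    refine ⟨Multiset.replicate (N - s.card) 0 + s, ⟨(hrep _ _).2 h1, ?_, ?_⟩, ?_⟩
    · rw [Multiset.card_add, Multiset.card_replicate]; omega
    · simpa using h3
    · rw [Multiset.filter_add, Multiset.filter_eq_nil.2, zero_add, Multiset.filter_eq_self]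
      · exact fun x hx h => h2 (h ▸ hx)
      · intro x hx
        simp [Multiset.eq_of_mem_replicate hx]

theorem coeff_indepSeries {G : SimpleGraph ℕ} {V : Set ℕ} (h0 : 0 ∈ V) (hG : ∀ x ∈ V, ¬ G.Adj 0 x)
    {n N : ℕ} (hn : n ≤ N) :
    coeff n (indepSeries G V N) =
      (({s | ((∀ x ∈ s, x ∈ V) ∧ G.IsIndepSet {x | x ∈ s}) ∧ 0 ∉ s ∧ s.sum = n} :
        Set (Multiset ℕ)).ncard : ℤ) := by
  rw [indepSeries, sumSeries, coeff_mk]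
  have := ncard_card_eq_of_cons_zero
    (A := {s | (∀ x ∈ s, x ∈ V) ∧ G.IsIndepSet {x | x ∈ s}}) (fun s => ?_) hn
  · simp only [Set.mem_ofPred_eq] at this
    rw [← this]
    congr 2
    ext s
    simp only [indepMultisets, Set.mem_ofPred_eq]
    tauto
  · simp only [Set.mem_ofPred_eq, isIndepSet_cons_iff, Multiset.forall_mem_cons]
    exact ⟨fun h => ⟨h.1.2, h.2.1⟩, fun h => ⟨⟨h0, h.1⟩, h.2, fun x hx => hG x (h.1 x hx)⟩⟩

/-! ### The recursion for the path -/

/-- The graph on `ℕ` whose edges are the pairs excluded by the difference conditions, namely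
`{3k + 1, 3k + 2}`, `{3k + 1, 3k + 3}` and `{3k, 3k + 2}`. It is the path
`0 - 2 - 1 - 3 - 5 - 4 - 6 - 8 - 7 - 9 - ⋯`. -/
def diffGraph : SimpleGraph ℕ :=
  SimpleGraph.fromRel fun x y => (y = x + 1 ∧ x % 3 = 1) ∨ (y = x + 2 ∧ x % 3 ≠ 2)

theorem diffGraph_adj (x y : ℕ) : diffGraph.Adj x y ↔
    ((y = x + 1 ∧ x % 3 = 1) ∨ (y = x + 2 ∧ x % 3 ≠ 2)) ∨
    ((x = y + 1 ∧ y % 3 = 1) ∨ (x = y + 2 ∧ y % 3 ≠ 2)) := by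
  rw [diffGraph, SimpleGraph.fromRel_adj]
  constructor
  · exact fun h => h.2
  · exact fun h => ⟨by omega, h⟩

theorem diffGraph_adj_add_three (x y : ℕ) :
    diffGraph.Adj (x + 3) (y + 3) ↔ diffGraph.Adj x y := by
  simp only [diffGraph_adj]
  omega

theorem indepSeries_diffGraph_ne_two (N : ℕ) :
    indepSeries diffGraph {x | x ≠ 2} (N + 1) = indepSeries diffGraph {x | x ≠ 2} N +
      X * indepSeries diffGraph {x | x = 1 ∨ 4 ≤ x} N +
      indepSeries diffGraph {x | 3 ≤ x} (N + 1) := by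
  have e1 : {x ∈ {x : ℕ | x ≠ 2} | ¬ diffGraph.Adj 0 x} = {x | x ≠ 2} := by
    ext x; simp only [diffGraph_adj, Set.mem_ofPred_eq]; omega
  have e2 : {x ∈ {x : ℕ | x ≠ 2} \ {0} | ¬ diffGraph.Adj 1 x} = {x | x = 1 ∨ 4 ≤ x} := by
    ext x
    simp only [diffGraph_adj, Set.mem_ofPred_eq, Set.mem_sdiff, Set.mem_singleton_iff]; omega
  have e3 : ({x : ℕ | x ≠ 2} \ {0}) \ {1} = {x | 3 ≤ x} := by
    ext x; simp only [Set.mem_ofPred_eq, Set.mem_sdiff, Set.mem_singleton_iff]; omega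
  rw [indepSeries_succ diffGraph (v := 0) (by simp),
    indepSeries_succ diffGraph (V := {x | x ≠ 2} \ {0}) (v := 1) (by simp), e1, e2, e3]
  ring

theorem indepSeries_diffGraph_one_or_four_le (N : ℕ) :
    indepSeries diffGraph {x | x = 1 ∨ 4 ≤ x} (N + 1) =
      X * indepSeries diffGraph {x | x = 1 ∨ 4 ≤ x} N +
      indepSeries diffGraph {x | 4 ≤ x} (N + 1) := by
  have e1 : {x ∈ {x : ℕ | x = 1 ∨ 4 ≤ x} | ¬ diffGraph.Adj 1 x} = {x | x = 1 ∨ 4 ≤ x} := by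
    ext x; simp only [diffGraph_adj, Set.mem_ofPred_eq]; omega
  have e2 : {x : ℕ | x = 1 ∨ 4 ≤ x} \ {1} = {x | 4 ≤ x} := by
    ext x; simp only [Set.mem_ofPred_eq, Set.mem_sdiff, Set.mem_singleton_iff]; omega
  rw [indepSeries_succ diffGraph (v := 1) (by simp), e1, e2]
  ring

theorem indepSeries_diffGraph_three_le (N : ℕ) :
    indepSeries diffGraph {x | 3 ≤ x} (N + 1) =
      X ^ (3 * (N + 1)) * indepSeries diffGraph {x | x ≠ 2} N +
      indepSeries diffGraph {x | 4 ≤ x} (N + 1) := by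
  have e1 : {x ∈ {x : ℕ | 3 ≤ x} | ¬ diffGraph.Adj 3 x} = (· + 3) '' {x | x ≠ 2} := by
    ext x
    simp only [diffGraph_adj, Set.mem_ofPred_eq, Set.mem_image]
    exact ⟨fun h => ⟨x - 3, by omega, by omega⟩, by rintro ⟨y, hy, rfl⟩; omega⟩
  have e2 : {x : ℕ | 3 ≤ x} \ {3} = {x | 4 ≤ x} := by
    ext x; simp only [Set.mem_ofPred_eq, Set.mem_sdiff, Set.mem_singleton_iff]; omega
  rw [indepSeries_succ diffGraph (v := 3) (by simp), e1, e2,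
    indepSeries_shift _ diffGraph_adj_add_three]
  ring

theorem indepSeries_diffGraph_four_le (N : ℕ) :
    indepSeries diffGraph {x | 4 ≤ x} (N + 1) =
      X ^ (3 * (N + 1) + 1) * indepSeries diffGraph {x | x = 1 ∨ 4 ≤ x} N +
      indepSeries diffGraph {x | 5 ≤ x} (N + 1) := by
  have e1 : {x ∈ {x : ℕ | 4 ≤ x} | ¬ diffGraph.Adj 4 x} =
      (· + 3) '' {x | x = 1 ∨ 4 ≤ x} := by
    ext x
    simp only [diffGraph_adj, Set.mem_ofPred_eq, Set.mem_image, and_true]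
    exact ⟨fun h => ⟨x - 3, by omega, by omega⟩, by rintro ⟨y, hy, rfl⟩; omega⟩
  have e2 : {x : ℕ | 4 ≤ x} \ {4} = {x | 5 ≤ x} := by
    ext x; simp only [Set.mem_ofPred_eq, Set.mem_sdiff, Set.mem_singleton_iff]; omega
  rw [indepSeries_succ diffGraph (v := 4) (by simp), e1, e2,
    indepSeries_shift _ diffGraph_adj_add_three]
  ring

theorem indepSeries_diffGraph_five_le (N : ℕ) :
    indepSeries diffGraph {x | 5 ≤ x} (N + 1) =
      X ^ 5 * indepSeries diffGraph {x | 5 ≤ x} N +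
      X ^ (3 * (N + 1)) * indepSeries diffGraph {x | 3 ≤ x} (N + 1) := by
  have e1 : {x ∈ {x : ℕ | 5 ≤ x} | ¬ diffGraph.Adj 5 x} = {x | 5 ≤ x} := by
    ext x; simp only [diffGraph_adj, Set.mem_ofPred_eq]; omega
  have e2 : {x : ℕ | 5 ≤ x} \ {5} = (· + 3) '' {x | 3 ≤ x} := by
    ext x
    simp only [Set.mem_ofPred_eq, Set.mem_sdiff, Set.mem_singleton_iff, Set.mem_image]
    exact ⟨fun h => ⟨x - 3, by omega, by omega⟩, by rintro ⟨y, hy, rfl⟩; omega⟩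
  rw [indepSeries_succ diffGraph (v := 5) (by simp), e1, e2,
    indepSeries_shift _ diffGraph_adj_add_three]
  ring

/-! ### The recursion for the edgeless graph -/

/-- The numbers congruent to `0`, `1` or `5` modulo `6`, including `0` itself. -/
def residues015 : Set ℕ := {x | x % 6 = 0 ∨ x % 6 = 1 ∨ x % 6 = 5}

theorem indepSeries_bot_succ {V : Set ℕ} {v : ℕ} (hv : v ∈ V) (N : ℕ) :
    indepSeries ⊥ V (N + 1) = indepSeries ⊥ (V \ {v}) (N + 1) + X ^ v * indepSeries ⊥ V N := by
  rw [indepSeries_succ ⊥ hv]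
  simp

theorem indepSeries_bot_residues015 (N : ℕ) :
    indepSeries ⊥ residues015 (N + 1) = indepSeries ⊥ residues015 N +
      indepSeries ⊥ (residues015 \ {0}) (N + 1) := by
  rw [indepSeries_bot_succ (v := 0) (by simp [residues015])]
  ring

theorem indepSeries_bot_residues015_diff_zero (N : ℕ) :
    indepSeries ⊥ (residues015 \ {0}) (N + 1) = X * indepSeries ⊥ (residues015 \ {0}) N +
      indepSeries ⊥ ((residues015 \ {0}) \ {1}) (N + 1) := by
  rw [indepSeries_bot_succ (v := 1) (by simp [residues015])]
  ring

theorem indepSeries_bot_residues015_diff_zero_one (N : ℕ) :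
    indepSeries ⊥ ((residues015 \ {0}) \ {1}) (N + 1) =
      X ^ 5 * indepSeries ⊥ ((residues015 \ {0}) \ {1}) N +
      X ^ (6 * (N + 1)) * indepSeries ⊥ residues015 (N + 1) := by
  have e : ((residues015 \ {0}) \ {1}) \ {5} = (· + 6) '' residues015 := by
    ext x
    simp only [residues015, Set.mem_ofPred_eq, Set.mem_sdiff, Set.mem_singleton_iff, Set.mem_image]
    exact ⟨fun h => ⟨x - 6, by omega, by omega⟩, by rintro ⟨y, hy, rfl⟩; omega⟩
  rw [indepSeries_bot_succ (v := 5) (by simp [residues015]), e,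
    indepSeries_shift _ (by simp)]
  ring

/-! ### Comparison of the two recursions -/

/-- Adding up the deletion steps gives, with `r = X ^ (3 * N)`, that `1 - r` times the first series
for the path, and `1 - r ^ 2` times the first series for the edgeless graph, are the same
combination of the three series of size `N - 1`. Hence the quotient gains the factor `1 + r` at each
step. The other two identities follow from the first and the deletion steps. -/
theorem indepSeries_diffGraph_eq (N : ℕ) :
    indepSeries diffGraph {x | x ≠ 2} N =
        (∏ j ∈ Finset.range N, (1 + X ^ (3 * (j + 1)))) * indepSeries ⊥ residues015 N ∧
      indepSeries diffGraph {x | x = 1 ∨ 4 ≤ x} N =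
        (∏ j ∈ Finset.range N, (1 + X ^ (3 * (j + 1)))) *
          indepSeries ⊥ (residues015 \ {0}) N ∧
      indepSeries diffGraph {x | 5 ≤ x} N =
        (∏ j ∈ Finset.range N, (1 + X ^ (3 * (j + 1)))) *
          indepSeries ⊥ ((residues015 \ {0}) \ {1}) N := by
  induction N with
  | zero => simp [indepSeries_zero]
  | succ N ih =>
    obtain ⟨ihc, ihb, iha⟩ := ih
    have hc := indepSeries_diffGraph_ne_two N
    have hb := indepSeries_diffGraph_one_or_four_le N
    have h3 := indepSeries_diffGraph_three_le N
    have h4 := indepSeries_diffGraph_four_le N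
    have ha := indepSeries_diffGraph_five_le N
    have kc := indepSeries_bot_residues015 N
    have kb := indepSeries_bot_residues015_diff_zero N
    have ka := indepSeries_bot_residues015_diff_zero_one N
    rw [ihc, ihb] at hc
    rw [ihb] at hb
    rw [ihc] at h3
    rw [ihb] at h4
    rw [iha] at ha
    have e6 : (X : ℤ⟦X⟧) ^ (6 * (N + 1)) = (X ^ (3 * (N + 1))) ^ 2 := by ring
    rw [e6] at ka
    rw [pow_succ] at h4
    rw [Finset.prod_range_succ]
    generalize (∏ j ∈ Finset.range N, (1 + X ^ (3 * (j + 1))) : ℤ⟦X⟧) = d at *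
    have hr : (1 - X ^ (3 * (N + 1)) : ℤ⟦X⟧) ≠ 0 := by
      intro h
      have := congrArg (coeff 0) h
      simp at this
    generalize (X ^ (3 * (N + 1)) : ℤ⟦X⟧) = r at *
    -- On the left, `(1 - r)` clears the term of size `N + 1` contributed by the translation.
    have main : indepSeries diffGraph {x | x ≠ 2} (N + 1) =
        d * (1 + r) * indepSeries ⊥ residues015 (N + 1) := by
      apply mul_left_cancel₀ hr
      linear_combination (1 - r) * hc + h3 + h4 + ha -
        d * kc - d * kb - d * ka
    refine ⟨main, ?_, ?_⟩
    · linear_combination main + hb - hc - h3 + d * (1 + r) * kc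
    · linear_combination main - hc - h3 - h4 + d * (1 + r) * (kc + kb)

/-! ### Euler's identity and the parts divisible by three -/

/-- Euler's identity `∏ (1 + y ^ j) = ∏ (1 - y ^ (2 * j - 1))⁻¹` in a finite form. -/
theorem prod_one_add_mul_prod_one_sub_odd {R : Type*} [CommRing R] (y : R) (M : ℕ) :
    (∏ j ∈ Finset.range (2 * M), (1 + y ^ (j + 1))) *
        (∏ j ∈ Finset.range M, (1 - y ^ (2 * j + 1))) *
        (∏ j ∈ Finset.range M, (1 - y ^ (2 * (j + 1)))) =
      ∏ j ∈ Finset.range (2 * M), (1 - y ^ (2 * (j + 1))) := by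
  induction M with
  | zero => simp
  | succ M ih =>
    rw [show 2 * (M + 1) = 2 * M + 1 + 1 by ring]
    simp only [Finset.prod_range_succ]
    rw [← ih]
    ring

/-- The generating function of the partitions whose parts lie in `V`, meaningful when `0 ∉ V`. -/
noncomputable def partitionSeries (V : Set ℕ) : ℤ⟦X⟧ :=
  sumSeries {s | ∀ x ∈ s, x ∈ V}

theorem partitionSeries_diff_singleton {V : Set ℕ} (h0 : 0 ∉ V) {v : ℕ} (hv : v ∈ V) :
    partitionSeries (V \ {v}) = (1 - X ^ v) * partitionSeries V := by
  have h := sumSeries_split (A := {s | ∀ x ∈ s, x ∈ V})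
    (finiteFibers_zero_notMem.mono fun s hs h => h0 (hs 0 h)) v
  have e1 : {s ∈ {s : Multiset ℕ | ∀ x ∈ s, x ∈ V} | v ∉ s} =
      {s | ∀ x ∈ s, x ∈ V \ {v}} := by
    ext s
    simp only [Set.mem_ofPred_eq, Set.mem_sdiff, Set.mem_singleton_iff]
    exact ⟨fun h x hx => ⟨h.1 x hx, fun hxv => h.2 (hxv ▸ hx)⟩,
      fun h => ⟨fun x hx => (h x hx).1, fun hv => (h v hv).2 rfl⟩⟩
  have e2 : {t : Multiset ℕ | v ::ₘ t ∈ {s : Multiset ℕ | ∀ x ∈ s, x ∈ V}} =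
      {s | ∀ x ∈ s, x ∈ V} := by
    ext s
    simp [hv]
  rw [e1, e2] at h
  rw [partitionSeries, partitionSeries]
  linear_combination -h

theorem coeff_partitionSeries_congr {V W : Set ℕ} {n : ℕ} (h : ∀ x ≤ n, x ∈ V ↔ x ∈ W) :
    coeff n (partitionSeries V) = coeff n (partitionSeries W) := by
  rw [partitionSeries, partitionSeries, sumSeries, sumSeries, coeff_mk, coeff_mk]
  congr 2
  ext s
  simp only [Set.mem_ofPred_eq]
  refine and_congr_left ?_
  rintro rfl
  exact forall₂_congr fun x hx => h x (Multiset.le_sum_of_mem hx)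

theorem partitionSeries_diff_odd_multiples {V : Set ℕ} (h0 : 0 ∉ V)
    (hV : ∀ j, 3 * (2 * j + 1) ∈ V) (M : ℕ) :
    partitionSeries (V \ {x | ∃ j < M, x = 3 * (2 * j + 1)}) =
      (∏ j ∈ Finset.range M, (1 - X ^ (3 * (2 * j + 1)))) * partitionSeries V := by
  induction M with
  | zero => simp
  | succ M ih =>
    have e : V \ {x | ∃ j < M + 1, x = 3 * (2 * j + 1)} =
        (V \ {x | ∃ j < M, x = 3 * (2 * j + 1)}) \ {3 * (2 * M + 1)} := by
      ext x
      simp only [Set.mem_sdiff, Set.mem_ofPred_eq, Set.mem_singleton_iff, Nat.lt_succ_iff_lt_or_eq,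
        or_and_right, exists_or, exists_eq_left, not_or, and_assoc]
    rw [e, partitionSeries_diff_singleton (fun h => h0 h.1), ih, Finset.prod_range_succ]
    · ring
    · refine ⟨hV M, ?_⟩
      rintro ⟨j, hj, h⟩
      omega

theorem X_pow_dvd_prod_sub_one {ι : Type*} (s : Finset ι) (f : ι → ℤ⟦X⟧) {m : ℕ}
    (h : ∀ i ∈ s, (X : ℤ⟦X⟧) ^ m ∣ f i - 1) : X ^ m ∣ ∏ i ∈ s, f i - 1 := by
  classical
  induction s using Finset.induction_on with
  | empty => simp
  | insert a s ha ih =>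
    rw [Finset.prod_insert ha]
    have h1 := h a (Finset.mem_insert_self a s)
    have h2 := ih fun i hi => h i (Finset.mem_insert_of_mem hi)
    have e : f a * ∏ i ∈ s, f i - 1 = f a * (∏ i ∈ s, f i - 1) + (f a - 1) := by ring
    rw [e]
    exact dvd_add (h2.mul_left _) h1

theorem coeff_eq_of_X_pow_dvd_sub_one {f g : ℤ⟦X⟧} {m n : ℕ} (h : X ^ m ∣ f - 1) (hn : n < m) :
    coeff n (f * g) = coeff n g := by
  have h1 : X ^ m ∣ f * g - g := by
    have : f * g - g = (f - 1) * g := by ring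
    rw [this]
    exact h.mul_right g
  have h2 := X_pow_dvd_iff.1 h1 n hn
  rw [map_sub] at h2
  omega

theorem X_pow_dvd_one_sub_X_pow_sub_one {m k : ℕ} (h : m ≤ k) :
    (X : ℤ⟦X⟧) ^ m ∣ (1 - X ^ k) - 1 := by
  have : (1 - X ^ k : ℤ⟦X⟧) - 1 = -X ^ k := by ring
  rw [this]
  exact (pow_dvd_pow X h).neg_right

/-- Euler's identity in the form in which it is used: modulo a high power of `X`, the product
`∏ (1 + X ^ (3 * j))` is inverse to the product of the `1 - X ^ i` over the odd multiples `i`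
of `3`. -/
theorem X_pow_dvd_euler_product_sub_one (M : ℕ) :
    (X : ℤ⟦X⟧) ^ (M + 1) ∣ (∏ j ∈ Finset.range (2 * M), (1 + X ^ (3 * (j + 1)))) *
      (∏ j ∈ Finset.range M, (1 - X ^ (3 * (2 * j + 1)))) - 1 := by
  have h := prod_one_add_mul_prod_one_sub_odd (X ^ 3 : ℤ⟦X⟧) M
  have hR : ∏ j ∈ Finset.range (2 * M), (1 - (X ^ 3) ^ (2 * (j + 1)) : ℤ⟦X⟧) =
      (∏ j ∈ Finset.range M, (1 - (X ^ 3) ^ (2 * (M + j + 1)))) *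
        ∏ j ∈ Finset.range M, (1 - (X ^ 3) ^ (2 * (j + 1))) := by
    rw [two_mul, Finset.prod_range_add, mul_comm]
  rw [hR] at h
  have hne : (∏ j ∈ Finset.range M, (1 - (X ^ 3) ^ (2 * (j + 1))) : ℤ⟦X⟧) ≠ 0 := by
    rw [Finset.prod_ne_zero_iff]
    intro j _ h0
    simpa using congrArg (coeff 0) h0
  have h' := mul_right_cancel₀ hne h
  simp only [← pow_mul] at h'
  rw [h']
  refine X_pow_dvd_prod_sub_one _ _ fun j _ => X_pow_dvd_one_sub_X_pow_sub_one ?_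
  omega

/-- The positive numbers congruent to `0`, `1`, `3` or `5` modulo `6`. -/
def positiveResidues0135 : Set ℕ :=
  {x | x ≠ 0 ∧ (x % 6 = 0 ∨ x % 6 = 1 ∨ x % 6 = 3 ∨ x % 6 = 5)}

theorem coeff_indepSeries_bot_residues015 {n N M : ℕ} (hN : n ≤ N) (hM : n ≤ M) :
    coeff n (indepSeries ⊥ residues015 N) =
      coeff n (partitionSeries
        (positiveResidues0135 \ {x | ∃ j < M, x = 3 * (2 * j + 1)})) := by
  have e : coeff n (partitionSeries
      (positiveResidues0135 \ {x | ∃ j < M, x = 3 * (2 * j + 1)})) =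
      coeff n (partitionSeries (residues015 \ {0})) := by
    refine coeff_partitionSeries_congr fun x hx => ?_
    simp only [positiveResidues0135, residues015, Set.mem_sdiff, Set.mem_ofPred_eq,
      Set.mem_singleton_iff]
    constructor
    · rintro ⟨⟨h0, h⟩, h'⟩
      have : x % 6 ≠ 3 := fun h3 => h' ⟨x / 6, by omega, by omega⟩
      omega
    · rintro ⟨h, h0⟩
      refine ⟨by omega, ?_⟩
      rintro ⟨j, -, rfl⟩
      omega
  rw [e, coeff_indepSeries (by simp [residues015]) (by simp) hN, partitionSeries, sumSeries,
    coeff_mk]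
  congr 2
  ext s
  have : (⊥ : SimpleGraph ℕ).IsIndepSet {x | x ∈ s} := fun x _ y _ _ h => h
  simp only [Set.mem_ofPred_eq, Set.mem_sdiff, Set.mem_singleton_iff, this, and_true]
  constructor
  · rintro ⟨h1, h2, h3⟩
    exact ⟨fun x hx => ⟨h1 x hx, fun h => h2 (h ▸ hx)⟩, h3⟩
  · rintro ⟨h1, h3⟩
    exact ⟨fun x hx => (h1 x hx).1, fun h => (h1 0 h).2 rfl, h3⟩

theorem coeff_indepSeries_diffGraph_eq_coeff_partitionSeries (n : ℕ) :
    coeff n (indepSeries diffGraph {x | x ≠ 2} (2 * n)) =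
      coeff n (partitionSeries positiveResidues0135) := by
  -- The size `2 * n` is even, as the finite form of Euler's identity requires, and at least `n`.
  have hH : X ^ (n + 1) ∣ indepSeries ⊥ residues015 (2 * n) - partitionSeries
      (positiveResidues0135 \ {x | ∃ j < n, x = 3 * (2 * j + 1)}) := by
    rw [X_pow_dvd_iff]
    intro m hm
    rw [map_sub, coeff_indepSeries_bot_residues015 (M := n) (by omega) (by omega), sub_self]
  have hD := hH.mul_left (∏ j ∈ Finset.range (2 * n), (1 + X ^ (3 * (j + 1))))
  have h1 := X_pow_dvd_iff.1 hD n (Nat.lt_succ_self n)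
  rw [mul_sub, map_sub, sub_eq_zero, ← (indepSeries_diffGraph_eq (2 * n)).1,
    partitionSeries_diff_odd_multiples, ← mul_assoc] at h1
  · rw [h1, coeff_eq_of_X_pow_dvd_sub_one (X_pow_dvd_euler_product_sub_one n)
      (Nat.lt_succ_self n)]
  · exact fun h => h.1 rfl
  · intro j
    rw [positiveResidues0135, Set.mem_ofPred_eq]
    omega

/-! ### Partitions as multisets -/

theorem ncard_partition_eq {n : ℕ} (P : Multiset ℕ → Prop) :
    {p : n.Partition | P p.parts}.ncard =
      ({s | P s ∧ 0 ∉ s ∧ s.sum = n} : Set (Multiset ℕ)).ncard := by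
  refine Set.ncard_congr (fun p _ => p.parts) ?_ ?_ ?_
  · exact fun p hp => ⟨hp, fun h => (p.parts_pos h).ne rfl, p.parts_sum⟩
  · exact fun p q _ _ h => Nat.Partition.ext h
  · rintro s ⟨h1, h2, h3⟩
    exact ⟨⟨s, fun {i} hi => Nat.pos_of_ne_zero fun h => h2 (h ▸ hi), h3⟩, h1, rfl⟩

theorem List.infix_of_no_intermediate {l : List ℕ} (hl : l.Pairwise fun a b => b ≤ a) {a b : ℕ}
    (ha : a ∈ l) (hb : b ∈ l) (hba : b < a) (h : ∀ c ∈ l, ¬ (b < c ∧ c < a)) : [a, b] <:+: l := by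
  induction l with
  | nil => simp at ha
  | cons x t ih =>
    obtain ⟨hx, ht⟩ := List.pairwise_cons.1 hl
    by_cases hat : a ∈ t
    · have hbt : b ∈ t := by
        rcases List.mem_cons.1 hb with rfl | hbt
        · have := hx a hat
          omega
        · exact hbt
      exact List.infix_cons (ih ht hat hbt fun c hc => h c (List.mem_cons_of_mem _ hc))
    · obtain rfl : a = x := (List.mem_cons.1 ha).resolve_right hat
      have hbt : b ∈ t := (List.mem_cons.1 hb).resolve_left hba.ne
      cases t with
      | nil => simp at hbt
      | cons y t' =>
        have h1 : y ≤ a := hx y List.mem_cons_self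
        have h2 : y ≠ a := fun e => hat (e ▸ List.mem_cons_self)
        have h3 : b ≤ y := by
          rcases List.mem_cons.1 hbt with rfl | hb'
          · exact le_rfl
          · exact (List.pairwise_cons.1 ht).1 b hb'
        have h4 := h y (by simp)
        obtain rfl : y = b := by omega
        exact (List.prefix_append [a, y] t').isInfix

theorem adjacentParts_of_no_intermediate {n : ℕ} {p : n.Partition} {a b : ℕ} (ha : a ∈ p.parts)
    (hb : b ∈ p.parts) (hba : b < a) (h : ∀ c ∈ p.parts, ¬ (b < c ∧ c < a)) :
    AdjacentParts p a b := by
  refine List.infix_of_no_intermediate (Multiset.pairwise_sort _ _) ?_ ?_ hba ?_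
  · exact (Multiset.mem_sort _).2 ha
  · exact (Multiset.mem_sort _).2 hb
  · exact fun c hc => h c ((Multiset.mem_sort _).1 hc)

theorem AdjacentParts.mem {n : ℕ} {p : n.Partition} {a b : ℕ} (h : AdjacentParts p a b) :
    a ∈ p.parts ∧ b ∈ p.parts := by
  have hs : ∀ c ∈ [a, b], c ∈ p.parts := fun c hc => (Multiset.mem_sort _).1 (h.subset hc)
  exact ⟨hs a (by simp), hs b (by simp)⟩

/-- The conditions on adjacent parts amount to conditions on arbitrary pairs of parts: an
excluded pair with difference `2` that is not adjacent has its middle element among the parts,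
and this yields an excluded adjacent pair with difference `1`. -/
theorem mem_partitionsC₂_iff {n : ℕ} (p : n.Partition) : p ∈ partitionsC₂ n ↔
    (∀ x ∈ p.parts, x ∈ {x | x ≠ 2}) ∧ diffGraph.IsIndepSet {x | x ∈ p.parts} := by
  constructor
  · rintro ⟨h1, h2, h3⟩
    refine ⟨fun x hx h => h3 (h ▸ hx), ?_⟩
    have hone : ∀ x ∈ p.parts, x + 1 ∈ p.parts → x % 3 ≠ 1 := fun x hx hx1 =>
      h1 (x + 1) x (adjacentParts_of_no_intermediate hx1 hx (by omega) fun c _ => by omega) rfl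
    have htwo : ∀ x ∈ p.parts, x + 2 ∈ p.parts → x % 3 = 2 := by
      intro x hx hx2
      by_cases hmid : x + 1 ∈ p.parts
      · have := hone x hx hmid
        have := hone (x + 1) hmid hx2
        omega
      · refine h2 (x + 2) x (adjacentParts_of_no_intermediate hx2 hx (by omega) ?_) rfl
        intro c hc hlt
        obtain rfl : c = x + 1 := by omega
        exact hmid hc
    intro x hx y hy _ hadj
    rw [diffGraph_adj] at hadj
    rcases hadj with (⟨rfl, h⟩ | ⟨rfl, h⟩) | (⟨rfl, h⟩ | ⟨rfl, h⟩)
    · exact hone x hx hy h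
    · exact h (htwo x hx hy)
    · exact hone y hy hx h
    · exact h (htwo y hy hx)
  · rintro ⟨h1, h2⟩
    refine ⟨fun a b hab e hb => ?_, fun a b hab e => ?_, fun h => h1 2 h rfl⟩
    · refine h2 (x := b) hab.mem.2 (y := a) hab.mem.1 (by omega) ((diffGraph_adj b a).2 ?_)
      exact Or.inl (Or.inl ⟨e, hb⟩)
    · by_contra hb
      refine h2 (x := b) hab.mem.2 (y := a) hab.mem.1 (by omega) ((diffGraph_adj b a).2 ?_)
      exact Or.inl (Or.inr ⟨e, hb⟩)

theorem C₁_eq_coeff (n : ℕ) : (C₁ n : ℤ) = coeff n (partitionSeries positiveResidues0135) := by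
  rw [C₁, partitionsC₁, ncard_partition_eq fun s => ∀ i ∈ s,
    i ≡ 0 [MOD 6] ∨ i ≡ 1 [MOD 6] ∨ i ≡ 3 [MOD 6] ∨ i ≡ 5 [MOD 6], partitionSeries, sumSeries,
    coeff_mk]
  congr 2
  ext s
  simp only [positiveResidues0135, Set.mem_ofPred_eq, Nat.ModEq]
  constructor
  · rintro ⟨h1, h2, h3⟩
    exact ⟨fun x hx => ⟨fun h => h2 (h ▸ hx), h1 x hx⟩, h3⟩
  · rintro ⟨h1, h3⟩
    exact ⟨fun x hx => (h1 x hx).2, fun h => (h1 0 h).1 rfl, h3⟩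

theorem C₂_eq_coeff {n N : ℕ} (hn : n ≤ N) :
    (C₂ n : ℤ) = coeff n (indepSeries diffGraph {x | x ≠ 2} N) := by
  have h : partitionsC₂ n = {p : n.Partition |
      (∀ x ∈ p.parts, x ∈ {x | x ≠ 2}) ∧ diffGraph.IsIndepSet {x | x ∈ p.parts}} :=
    Set.ext mem_partitionsC₂_iff
  rw [C₂, h, ncard_partition_eq fun s => (∀ x ∈ s, x ∈ {x | x ≠ 2}) ∧
    diffGraph.IsIndepSet {x | x ∈ s}, coeff_indepSeries (by simp) ?_ hn]
  intro x hx
  rw [diffGraph_adj]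
  rw [Set.mem_ofPred_eq] at hx
  omega

theorem mainTheorem3 (n : ℕ) :
    C₁ n = C₂ n ∧
      ∀ (p : n.Partition) (a b : ℕ), AdjacentParts p a b →
        (a = b + 1 → (¬ b ≡ 1 [MOD 3] ↔ ¬ a + b ≡ 0 [MOD 3])) ∧
        (a = b + 2 → (b ≡ 2 [MOD 3] ↔ a + b ≡ 0 [MOD 3])) := by
  refine ⟨?_, fun p a b _ => ⟨?_, ?_⟩⟩
  · have h : (C₁ n : ℤ) = C₂ n := by
      rw [C₁_eq_coeff, C₂_eq_coeff (N := 2 * n) (by omega),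
        coeff_indepSeries_diffGraph_eq_coeff_partitionSeries]
    exact_mod_cast h
  · rintro rfl
    simp only [Nat.ModEq]
    omega
  · rintro rfl
    simp only [Nat.ModEq]
    omega
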